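/- **Setting.** Let $E_{ij}$ ($i,j\in\{0,1,2\}$) be the elementary $3\times3$ matrices acting on $\mathbb C^3$, let $P$ be the permutation operator of $\mathbb C^3\otimes\mathbb C^3$, and let $\mathfrak s^z=\mathrm{diag}(0,1,2)$, $S^z=\mathfrak s^z\otimes\mathbb I+\mathbb I\otimes\mathfrak s^z$. A *bivariate $R$-matrix* is an analytic map $(x,y)\mapsto\check R(x,y)\in\mathrm{End}(\mathbb C^3\otimes\mathbb C^3)$ on $U\times U$, with $U\subseteq\mathbb C$ open, that is regular, $\check R(x,x)=\mathbb I$, and satisfies the braided Yang–Baxter equation $$\check R_{12}(y,z)\check R_{23}(x,z)\check R_{12}(x,y)=\check R_{23}(x,y)\check R_{12}(x,z)\check R_{23}(y,z)\qquad(x,y,z\in U).$$ A *univariate $R$-matrix* is an analytic $\check R(u)$ on an open neighbourhood $V$ of $u_0$, regular in the sense $\check R(u_0)=\mathbb I$, which is either additive ($u_0=0$, $\check R_{12}(u)\check R_{23}(u+v)\check R_{12}(v)=\check R_{23}(v)\check R_{12}(u+v)\check R_{23}(u)$ whenever $u,v,u+v\in V$) or multiplicative ($u_0=1$, the same equation with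 $uv$ in place of $u+v$). Say that $\check R$ *generates* the two-site Hamiltonian $H$ if $\partial_x\check R(x,t)|_{x=t}$ for some $t\in U$ (in the univariate cases $\check R'(u_0)$) equals $$\kappa\,\bigl(H+\alpha\,\mathbb I+\beta S^z+A\otimes\mathbb I-\mathbb I\otimes A\bigr)$$ for some $\kappa,\alpha,\beta\in\mathbb C$, $\kappa\neq0$, and some diagonal matrix $A$; that is, the Hamiltonian is considered up to rescaling of the spectral parameter, shifts by the identity and by $S^z$, and telescopic terms. For $\xi\in\mathbb C$ let $$H_{14V}=E_{01}\otimes E_{10}+E_{01}\otimes E_{21}-E_{21}\otimes E_{01}+E_{12}\otimes E_{21}+E_{02}\otimes E_{20}+\sum_{i,j}v_{ij}E_{ii}\otimes E_{jj},$$ where the non-vanishing $v_{ij}$ are $v_{02}=v_{20}=\tfrac12$, $v_{11}=1$, $v_{12}=\tfrac32$, $v_{21}=\xi-\tfrac32$, $v_{22}=\xi$. For $\theta_0\in\mathbb C$ let $$H_{17V_2}(\theta_0)=E_{01}\otimes E_{10}+\theta_0E_{10}\otimes E_{01}+E_{01}\otimes E_{21}-E_{21}\otimes E_{01}+E_{12}\otimes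 E_{21}+\theta_0E_{21}\otimes E_{12}+E_{02}\otimes E_{20}+\theta_0E_{20}\otimes E_{02}+\sum_{i,j}w_{ij}E_{ii}\otimes E_{jj},$$ where the $w_{ij}$ other than the following vanish: $w_{02}=w_{20}=\tfrac{1+\theta_0}2$, $w_{11}=1+\theta_0$, $w_{12}=\tfrac{3+\theta_0}2$, $w_{21}=\tfrac{1+3\theta_0}2$, $w_{22}=2(1+\theta_0)$. Finally, for $z\ne0$ put $\omega=z-\frac1z$ and let $\check R_{\theta_0}(z)=P\,R_{\theta_0}(z)$, where, in the basis $|ij\rangle$ ordered lexicographically, $$R_{\theta_0}(z)=\begin{pmatrix} z-\frac{\theta_0}z&0&0&0&0&0&0&0&0\\ 0&\omega\theta_0&0&\frac{1-\theta_0}z&0&0&0&0&0\\ 0&0&\omega\theta_0&0&-\omega&0&\frac{1-\theta_0}z&0&0\\ 0&z(1-\theta_0)&0&\omega&0&0&0&0&0\\ 0&0&0&0&z-\frac{\theta_0}z&0&0&0&0\\ 0&0&0&0&0&\omega\theta_0&0&\frac{1-\theta_0}z&0\\ 0&0&z(1-\theta_0)&0&\omega&0&\omega&0&0\\ 0&0&0&0&0&z(1-\theta_0)&0&\omega&0\\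 0&0&0&0&0&0&0&0&z-\frac{\theta_0}z \end{pmatrix}.$$ **Statement.** 1. If $\xi\neq2$, then no bivariate and no univariate (additive or multiplicative) $R$-matrix generates $H_{14V}$. 2. For every $\theta_0\ne1$, $(1-\theta_0)^{-1}\check R_{\theta_0}(z)$ is a multiplicative $R$-matrix on $\mathbb C\setminus\{0\}$ and generates $H_{17V_2}(\theta_0)$. 3. $H_{14V}|_{\xi=2}=H_{17V_2}(0)$. Consequently $\check R_0(z)$ is a multiplicative $R$-matrix on $\mathbb C\setminus\{0\}$ which generates $H_{14V}|_{\xi=2}$; moreover it is unitary, $\check R_0(z)\check R_0(1/z)=\mathbb I$. -/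

import Mathlib

open scoped Kronecker

noncomputable section

namespace ThreeState

/-- Operators on one site `ℂ³` with basis `|0⟩, |1⟩, |2⟩`. -/
abbrev OneSite := Matrix (Fin 3) (Fin 3) ℂ

/-- Operators on two sites `ℂ³ ⊗ ℂ³`, with basis `|i⟩ ⊗ |j⟩` indexed by the pairs `(i, j)`. -/
abbrev TwoSite := Matrix (Fin 3 × Fin 3) (Fin 3 × Fin 3) ℂ

/-- Operators on three sites `ℂ³ ⊗ ℂ³ ⊗ ℂ³`. -/
abbrev ThreeSite := Matrix ((Fin 3 × Fin 3) × Fin 3) ((Fin 3 × Fin 3) × Fin 3) ℂ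

/-- The elementary matrix `E_{ij}`. -/
def E (i j : Fin 3) : OneSite := Matrix.single i j 1

/-- `M₁₂ = M ⊗ 𝕀`. -/
def site12 (M : TwoSite) : ThreeSite := M ⊗ₖ (1 : OneSite)

/-- `M₂₃ = 𝕀 ⊗ M`. -/
def site23 (M : TwoSite) : ThreeSite :=
  Matrix.reindex (Equiv.prodAssoc _ _ _).symm (Equiv.prodAssoc _ _ _).symm ((1 : OneSite) ⊗ₖ M)

/-- The permutation operator `P (|i⟩ ⊗ |j⟩) = |j⟩ ⊗ |i⟩`. -/
def permOp : TwoSite := fun a b => if a.1 = b.2 ∧ a.2 = b.1 then 1 else 0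

/-- The braided matrix `Ř = P R`, i.e. `R = P Ř`. -/
def braided (R : TwoSite) : TwoSite := permOp * R

/-- The one-site spin `𝔰ᶻ |j⟩ = j |j⟩`. -/
def spin : OneSite := Matrix.diagonal fun j => (j.val : ℂ)

/-- The two-site spin `Sᶻ = 𝔰ᶻ ⊗ 𝕀 + 𝕀 ⊗ 𝔰ᶻ`. -/
def spinTwo : TwoSite := spin ⊗ₖ (1 : OneSite) + (1 : OneSite) ⊗ₖ spin

/-- The telescopic term `A ⊗ 𝕀 - 𝕀 ⊗ A` with `A = diag a`. -/
def telescopic (a : Fin 3 → ℂ) : TwoSite :=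
  Matrix.diagonal a ⊗ₖ (1 : OneSite) - (1 : OneSite) ⊗ₖ Matrix.diagonal a

/-- `H'` is obtained from `H` by a shift by the identity, a shift by `Sᶻ`, a diagonal telescopic
term, and a non-zero rescaling (which amounts to a change of scale of the spectral parameter).
These are the transformations modulo which a local Hamiltonian is derived from an `R`-matrix. -/
def HamiltonianEquiv (H H' : TwoSite) : Prop :=
  ∃ (κ α β : ℂ) (a : Fin 3 → ℂ), κ ≠ 0 ∧
    H' = κ • (H + α • (1 : TwoSite) + β • spinTwo + telescopic a)

/-- A regular analytic solution `Ř(x, y)`, `x, y ∈ U`, of the braided Yang–Baxter equation. -/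
structure IsBivariateRMatrix (U : Set ℂ) (R : ℂ → ℂ → TwoSite) : Prop where
  isOpen : IsOpen U
  analytic : ∀ i j, AnalyticOnNhd ℂ (fun p : ℂ × ℂ => R p.1 p.2 i j) (U ×ˢ U)
  regular : ∀ x ∈ U, R x x = 1
  yangBaxter : ∀ x ∈ U, ∀ y ∈ U, ∀ z ∈ U,
    site12 (R y z) * site23 (R x z) * site12 (R x y) =
      site23 (R x y) * site12 (R x z) * site23 (R y z)

/-- A regular analytic solution `Ř(u)`, `u ∈ V`, of the braided Yang–Baxter equation with additive
spectral parameter, i.e. `Ř(x, y) = Ř(x - y)`. -/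
structure IsAdditiveRMatrix (V : Set ℂ) (R : ℂ → TwoSite) : Prop where
  isOpen : IsOpen V
  zero_mem : (0 : ℂ) ∈ V
  analytic : ∀ i j, AnalyticOnNhd ℂ (fun u => R u i j) V
  regular : R 0 = 1
  yangBaxter : ∀ u ∈ V, ∀ v ∈ V, u + v ∈ V →
    site12 (R u) * site23 (R (u + v)) * site12 (R v) =
      site23 (R v) * site12 (R (u + v)) * site23 (R u)

/-- A regular analytic solution `Ř(u)`, `u ∈ V`, of the braided Yang–Baxter equation with
multiplicative spectral parameter, i.e. `Ř(x, y) = Ř(x / y)`. -/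
structure IsMultiplicativeRMatrix (V : Set ℂ) (R : ℂ → TwoSite) : Prop where
  isOpen : IsOpen V
  one_mem : (1 : ℂ) ∈ V
  analytic : ∀ i j, AnalyticOnNhd ℂ (fun u => R u i j) V
  regular : R 1 = 1
  yangBaxter : ∀ u ∈ V, ∀ v ∈ V, u * v ∈ V →
    site12 (R u) * site23 (R (u * v)) * site12 (R v) =
      site23 (R v) * site12 (R (u * v)) * site23 (R u)

/-- Up to the transformations of `HamiltonianEquiv`, `H = ∂ₓ Ř(x, t) |_{x = t}`. -/
def GeneratesAt (R : ℂ → ℂ → TwoSite) (t : ℂ) (H : TwoSite) : Prop :=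
  ∃ H' : TwoSite, HamiltonianEquiv H H' ∧ ∀ i j, HasDerivAt (fun x => R x t i j) (H' i j) t

/-- Up to the transformations of `HamiltonianEquiv`, `H = Ř'(u₀)`, where `u₀` is the value of the
spectral parameter at which `Ř` is regular: `u₀ = 0` (additive) or `u₀ = 1` (multiplicative). -/
def GeneratesUniAt (R : ℂ → TwoSite) (u₀ : ℂ) (H : TwoSite) : Prop :=
  ∃ H' : TwoSite, HamiltonianEquiv H H' ∧ ∀ i j, HasDerivAt (fun u => R u i j) (H' i j) u₀

/-- Some bivariate `R`-matrix, defined near some point `(t, t)`, generates `H` at `t`. -/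
def HasBivariateRMatrix (H : TwoSite) : Prop :=
  ∃ (U : Set ℂ) (R : ℂ → ℂ → TwoSite) (t : ℂ), IsBivariateRMatrix U R ∧ t ∈ U ∧ GeneratesAt R t H

/-- Some univariate `R`-matrix with additive spectral parameter generates `H`. -/
def HasAdditiveRMatrix (H : TwoSite) : Prop :=
  ∃ (V : Set ℂ) (R : ℂ → TwoSite), IsAdditiveRMatrix V R ∧ GeneratesUniAt R 0 H

/-- Some univariate `R`-matrix with multiplicative spectral parameter generates `H`. -/
def HasMultiplicativeRMatrix (H : TwoSite) : Prop :=
  ∃ (V : Set ℂ) (R : ℂ → TwoSite), IsMultiplicativeRMatrix V R ∧ GeneratesUniAt R 1 H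

/-- The diagonal parameters `v_{ij}` of the 14-vertex Hamiltonian. -/
def v14 (ξ : ℂ) : Matrix (Fin 3) (Fin 3) ℂ :=
  !![0, 0, 1 / 2;
     0, 1, 3 / 2;
     1 / 2, ξ - 3 / 2, ξ]

/-- The 14-vertex two-site Hamiltonian. -/
def H14V (ξ : ℂ) : TwoSite :=
  E 0 1 ⊗ₖ E 1 0 + E 0 1 ⊗ₖ E 2 1 - E 2 1 ⊗ₖ E 0 1 + E 1 2 ⊗ₖ E 2 1 + E 0 2 ⊗ₖ E 2 0
    + ∑ i, ∑ j, v14 ξ i j • (E i i ⊗ₖ E j j)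

/-- The diagonal parameters of the Hamiltonian `H_{17V₂}`, in the normalisation
`v₀₀ = v₀₁ = v₁₀ = 0`, `v₀₂ = v₂₀` (attained by the transformations of `HamiltonianEquiv`). -/
def v17 (θ : ℂ) : Matrix (Fin 3) (Fin 3) ℂ :=
  !![0, 0, (1 + θ) / 2;
     0, 1 + θ, (3 + θ) / 2;
     (1 + θ) / 2, (1 + 3 * θ) / 2, 2 * (1 + θ)]

/-- The 17-vertex two-site Hamiltonian `H_{17V₂}` with parameter `θ = θ₀`. -/
def H17V2 (θ : ℂ) : TwoSite :=
  E 0 1 ⊗ₖ E 1 0 + θ • (E 1 0 ⊗ₖ E 0 1) + E 0 1 ⊗ₖ E 2 1 - E 2 1 ⊗ₖ E 0 1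
    + E 1 2 ⊗ₖ E 2 1 + θ • (E 2 1 ⊗ₖ E 1 2) + E 0 2 ⊗ₖ E 2 0 + θ • (E 2 0 ⊗ₖ E 0 2)
    + ∑ i, ∑ j, v17 θ i j • (E i i ⊗ₖ E j j)

/-- The (non-braided) 17-vertex `R`-matrix with parameter `θ = θ₀`; the nine basis vectors
`|i⟩ ⊗ |j⟩` are numbered by `3 i + j`. -/
def R17V2 (θ z : ℂ) : TwoSite :=
  Matrix.submatrix
    (!![z - θ / z, 0, 0, 0, 0, 0, 0, 0, 0;
        0, (z - 1 / z) * θ, 0, (1 - θ) / z, 0, 0, 0, 0, 0;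
        0, 0, (z - 1 / z) * θ, 0, 1 / z - z, 0, (1 - θ) / z, 0, 0;
        0, z * (1 - θ), 0, z - 1 / z, 0, 0, 0, 0, 0;
        0, 0, 0, 0, z - θ / z, 0, 0, 0, 0;
        0, 0, 0, 0, 0, (z - 1 / z) * θ, 0, (1 - θ) / z, 0;
        0, 0, z * (1 - θ), 0, z - 1 / z, 0, z - 1 / z, 0, 0;
        0, 0, 0, 0, 0, z * (1 - θ), 0, z - 1 / z, 0;
        0, 0, 0, 0, 0, 0, 0, 0, z - θ / z] : Matrix (Fin (3 * 3)) (Fin (3 * 3)) ℂ)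
    finProdFinEquiv finProdFinEquiv

end ThreeState

end

namespace ThreeState

open scoped Topology

/-! Nonexistence: expand the Yang–Baxter equation at the spectral points `t + ε, t, t - ε`.
Regularity makes orders zero and one automatic. Order two gives `X₁₂ = X₂₃` for `X = F + G + H² -
S`, which eliminates `S`, the second coefficient of `Ř(t + ε, t - ε)`. Order three becomes a cubic
condition on `H` that is linear in the unknown `K = F - G`, up to operators on a single bond
(`exists_of_hasTaylor`). The functional `obstruction` kills every unknown and turns the condition
into `2κ³(2 - ξ) = 0`. Univariate solutions reduce to bivariate ones through `exp` and `x - y`.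

Existence: `Ř` is the Baxterization of a matrix `B` satisfying the braid relation and the Hecke
relation `(B - 1)(B + θ) = 0`, so the Yang–Baxter equation follows from algebra alone
(`yangBaxter_of_braid`). At `θ = 0`, `B` is a projector, whence unitarity. -/

/-! ### Third-order Taylor expansions. -/

theorem analyticAt_dslope_self {f : ℂ → ℂ} {z : ℂ} (hf : AnalyticAt ℂ f z) :
    AnalyticAt ℂ (dslope f z) z := by
  obtain ⟨p, hp⟩ := hf
  exact ⟨_, hp.has_fpower_series_dslope_fslope⟩

theorem eq_zero_of_smul_eventually {A : Type*} [AddCommGroup A] [Module ℂ A] [TopologicalSpace A]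
    [T2Space A] {Z : ℂ → A} (hZ : ContinuousAt Z 0) {n : ℕ}
    (h : ∀ᶠ ε in 𝓝 (0 : ℂ), ε ^ n • Z ε = 0) : Z 0 = 0 := by
  have h0 : ∀ᶠ ε in 𝓝[≠] (0 : ℂ), Z ε = 0 := by
    filter_upwards [h.filter_mono nhdsWithin_le_nhds, self_mem_nhdsWithin] with ε h1 h2
    exact (smul_eq_zero_iff_right (pow_ne_zero n h2)).1 h1
  refine tendsto_nhds_unique (hZ.tendsto.mono_left (nhdsWithin_le_nhds (s := {0}ᶜ))) ?_
  exact tendsto_const_nhds.congr' (h0.mono fun ε hε => hε.symm)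

/-- `f` has the Taylor coefficients `a₀, a₁, a₂, a₃` at `0`. -/
def HasTaylor {A : Type*} [AddCommGroup A] [Module ℂ A] [TopologicalSpace A]
    (f : ℂ → A) (a₀ a₁ a₂ a₃ : A) : Prop :=
  ∃ r : ℂ → A, ContinuousAt r 0 ∧ r 0 = a₃ ∧
    ∀ ε, f ε = a₀ + ε • a₁ + ε ^ 2 • a₂ + ε ^ 3 • r ε

/-- Iterated divided differences at `0` stay analytic; the third one is the continuous remainder. -/
theorem exists_hasTaylor {f : ℂ → ℂ} {d : ℂ} (hf : AnalyticAt ℂ f 0) (hd : HasDerivAt f d 0) :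
    ∃ a₂ a₃ : ℂ, HasTaylor f (f 0) d a₂ a₃ := by
  have h1 := analyticAt_dslope_self hf
  have h2 := analyticAt_dslope_self h1
  have h3 := analyticAt_dslope_self h2
  refine ⟨dslope (dslope f 0) 0 0, _, _, h3.continuousAt, rfl, fun ε => ?_⟩
  have e1 := sub_smul_dslope f 0 ε
  have e2 := sub_smul_dslope (dslope f 0) 0 ε
  have e3 := sub_smul_dslope (dslope (dslope f 0) 0) 0 ε
  rw [dslope_same f, hd.deriv] at e2
  simp only [sub_zero, smul_eq_mul] at e1 e2 e3 ⊢
  linear_combination -e1 - ε * e2 - ε ^ 2 * e3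

theorem exists_hasTaylor_matrix {f : ℂ → TwoSite} {D : TwoSite}
    (hf : ∀ i j, AnalyticAt ℂ (fun ε => f ε i j) 0)
    (hd : ∀ i j, HasDerivAt (fun ε => f ε i j) (D i j) 0) :
    ∃ a₂ a₃ : TwoSite, HasTaylor f (f 0) D a₂ a₃ := by
  choose C C' r hr hr' h using fun i j => exists_hasTaylor (hf i j) (hd i j)
  refine ⟨Matrix.of C, Matrix.of C', fun ε => Matrix.of fun i j => r i j ε, ?_, ?_, fun ε => ?_⟩
  · exact continuousAt_pi.2 fun i => continuousAt_pi.2 fun j => hr i j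
  · ext i j
    exact hr' i j
  · ext i j
    simpa using h i j ε

theorem HasTaylor.map {A B : Type*} [AddCommGroup A] [Module ℂ A] [TopologicalSpace A]
    [AddCommGroup B] [Module ℂ B] [TopologicalSpace B] {f : ℂ → A} {a₀ a₁ a₂ a₃ : A}
    (hf : HasTaylor f a₀ a₁ a₂ a₃) (φ : A →ₗ[ℂ] B) (hφ : Continuous φ) :
    HasTaylor (fun ε => φ (f ε)) (φ a₀) (φ a₁) (φ a₂) (φ a₃) := by
  obtain ⟨r, hr, rfl, h⟩ := hf
  refine ⟨fun ε => φ (r ε), hφ.continuousAt.comp hr, rfl, fun ε => ?_⟩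
  simp [h]

theorem HasTaylor.mul {A : Type*} [Ring A] [Algebra ℂ A] [TopologicalSpace A]
    [IsTopologicalRing A] [ContinuousSMul ℂ A] {f g : ℂ → A} {a₀ a₁ a₂ a₃ b₀ b₁ b₂ b₃ : A}
    (hf : HasTaylor f a₀ a₁ a₂ a₃) (hg : HasTaylor g b₀ b₁ b₂ b₃) :
    HasTaylor (fun ε => f ε * g ε) (a₀ * b₀) (a₀ * b₁ + a₁ * b₀)
      (a₀ * b₂ + a₁ * b₁ + a₂ * b₀) (a₀ * b₃ + a₁ * b₂ + a₂ * b₁ + a₃ * b₀) := by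
  obtain ⟨r, hr, rfl, hf⟩ := hf
  obtain ⟨s, hs, rfl, hg⟩ := hg
  refine ⟨fun ε => (a₀ * s ε + a₁ * b₂ + a₂ * b₁ + r ε * b₀)
    + ε • (a₁ * s ε + a₂ * b₂ + r ε * b₁) + ε ^ 2 • (a₂ * s ε + r ε * b₂)
    + ε ^ 3 • (r ε * s ε), by fun_prop, by simp, fun ε => ?_⟩
  simp only [hf, hg, mul_add, add_mul, smul_add, smul_smul, smul_mul_assoc, mul_smul_comm]
  module

theorem HasTaylor.coeff_eq {A : Type*} [AddCommGroup A] [Module ℂ A] [TopologicalSpace A]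
    [IsTopologicalAddGroup A] [ContinuousSMul ℂ A] [T2Space A] {f g : ℂ → A}
    {a₀ a₁ a₂ a₃ b₂ b₃ : A}
    (hf : HasTaylor f a₀ a₁ a₂ a₃) (hg : HasTaylor g a₀ a₁ b₂ b₃) (h : ∀ᶠ ε in 𝓝 0, f ε = g ε) :
    a₂ = b₂ ∧ a₃ = b₃ := by
  obtain ⟨r, hr, rfl, hf⟩ := hf
  obtain ⟨s, hs, rfl, hg⟩ := hg
  have h2 : a₂ = b₂ := by
    have := eq_zero_of_smul_eventually (n := 2)
      (Z := fun ε => (a₂ - b₂) + ε • (r ε - s ε)) (by fun_prop) <| h.mono fun ε hε => by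
        rw [hf, hg, ← sub_eq_zero] at hε
        rw [← hε]
        module
    simpa [sub_eq_zero] using this
  refine ⟨h2, ?_⟩
  have := eq_zero_of_smul_eventually (n := 3)
    (Z := fun ε => r ε - s ε) (by fun_prop) <| h.mono fun ε hε => by
      rw [hf, hg, h2, ← sub_eq_zero] at hε
      rw [← hε]
      module
  simpa [sub_eq_zero] using this

/-! ### The Yang–Baxter equation to third order. -/

/-- `site12` as a homomorphism of algebras. -/
def site12Hom : TwoSite →ₐ[ℂ] ThreeSite where
  toFun := site12
  map_one' := by simp [site12]
  map_zero' := by simp [site12]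
  map_add' := fun M N => by simp [site12, Matrix.add_kronecker]
  map_mul' := fun M N => by simp [site12, ← Matrix.mul_kronecker_mul]
  commutes' := fun c => by
    simp [site12, Algebra.algebraMap_eq_smul_one, Matrix.smul_kronecker]

/-- `site23` as a homomorphism of algebras. -/
def site23Hom : TwoSite →ₐ[ℂ] ThreeSite where
  toFun := site23
  map_one' := by simp [site23]
  map_zero' := by simp [site23]
  map_add' := fun M N => by
    ext; simp [site23, Matrix.kronecker_add]
  map_mul' := fun M N => by
    simp only [site23, Matrix.reindex_apply, Matrix.submatrix_mul_equiv,
      ← Matrix.mul_kronecker_mul, mul_one]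
  commutes' := fun c => by
    simp [site23, Algebra.algebraMap_eq_smul_one, Matrix.kronecker_smul, Matrix.submatrix_smul]

theorem continuous_site12 : Continuous site12 :=
  continuous_pi fun p => continuous_pi fun q => by
    simp only [site12, Matrix.kroneckerMap_apply]
    fun_prop

theorem continuous_site23 : Continuous site23 :=
  continuous_pi fun p => continuous_pi fun q => by
    simp only [site23, Matrix.kroneckerMap_apply, Matrix.reindex_apply, Matrix.submatrix_apply]
    fun_prop

/-- The compatibility condition on a Hamiltonian `H` obtained from the terms of third order of the
Yang–Baxter equation. -/
theorem exists_of_hasTaylor {f g h : ℂ → TwoSite} {H F F' G G' S S' : TwoSite}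
    (hf : HasTaylor f 1 H F F') (hg : HasTaylor g 1 H G G') (hh : HasTaylor h 1 (H + H) S S')
    (hyb : ∀ᶠ ε in 𝓝 0, site12 (g ε) * site23 (h ε) * site12 (f ε) =
      site23 (f ε) * site12 (h ε) * site23 (g ε)) :
    ∃ K B C : TwoSite,
      2 * (site12 H * site23 H * site12 H - site23 H * site12 H * site23 H)
      + (site12 H * site23 (H * H) + site23 (H * H) * site12 H)
      - (site23 H * site12 (H * H) + site12 (H * H) * site23 H)
      + (site12 H * site23 K - site23 K * site12 H)
      + (site23 H * site12 K - site12 K * site23 H)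
      + site12 B + site23 C = 0 := by
  have c1 : Continuous site12Hom.toLinearMap := continuous_site12
  have c2 : Continuous site23Hom.toLinearMap := continuous_site23
  have hl := ((hg.map _ c1).mul (hh.map _ c2)).mul (hf.map _ c1)
  have hr := ((hf.map _ c2).mul (hh.map _ c1)).mul (hg.map _ c2)
  simp only [AlgHom.toLinearMap_apply, map_one, map_add, one_mul, mul_one] at hl hr
  -- Both first-order coefficients equal `2(H₁₂ + H₂₃)`; they must agree syntactically for
  -- `coeff_eq`.
  rw [show site23Hom H + (site12Hom H + site12Hom H + site23Hom H) =
    site12Hom H + (site23Hom H + site23Hom H + site12Hom H) by abel] at hr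
  obtain ⟨e2, e3⟩ := hl.coeff_eq hr hyb
  set X := F + G + H * H - S with hX
  have hX12 : site12Hom X = site23Hom X := by
    simp only [hX, map_add, map_sub, map_mul]
    rw [← sub_eq_zero] at e2 ⊢
    rw [← e2]
    noncomm_ring
  have hS : S = F + G + H * H - X := by rw [hX]; abel
  -- `B` and `C` collect the third-order terms living on one bond. Mixed terms such as `H₁₂ X₂₃`
  -- join them because `X₂₃ = X₁₂`.
  refine ⟨F - G, G' + F' + G * H + H * F - S' - (H * X + X * H),
    S' - (G' + F' + F * H + H * G) + (H * X + X * H), ?_⟩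
  change 2 * (site12Hom H * site23Hom H * site12Hom H - site23Hom H * site12Hom H * site23Hom H)
      + (site12Hom H * site23Hom (H * H) + site23Hom (H * H) * site12Hom H)
      - (site23Hom H * site12Hom (H * H) + site12Hom (H * H) * site23Hom H)
      + (site12Hom H * site23Hom (F - G) - site23Hom (F - G) * site12Hom H)
      + (site23Hom H * site12Hom (F - G) - site12Hom (F - G) * site23Hom H)
      + site12Hom _ + site23Hom _ = 0
  rw [hS, ← sub_eq_zero] at e3
  rw [← e3]
  simp only [map_add, map_sub, map_mul, hX12]
  noncomm_ring

/-! ### The obstruction functional on the 14-vertex Hamiltonian. -/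

/-- A linear functional that detects the obstruction to the Yang–Baxter equation. -/
def obstruction : ThreeSite →ₗ[ℂ] ℂ where
  toFun M := M ((2, 0), 2) ((1, 2), 1) + M ((2, 2), 0) ((1, 2), 1) + M ((0, 2), 2) ((1, 2), 1)
    - M ((0, 0), 2) ((1, 0), 1) - M ((0, 2), 0) ((1, 0), 1) - M ((2, 0), 0) ((1, 0), 1)
  map_add' M N := by simp only [Matrix.add_apply]; ring
  map_smul' c M := by simp only [Matrix.smul_apply, smul_eq_mul, RingHom.id_apply]; ring

theorem site12_apply (M : TwoSite) (i j k l m n : Fin 3) :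
    site12 M ((i, j), k) ((l, m), n) = if k = n then M (i, j) (l, m) else 0 := by
  simp [site12, Matrix.one_apply]

theorem site23_apply (M : TwoSite) (i j k l m n : Fin 3) :
    site23 M ((i, j), k) ((l, m), n) = if i = l then M (j, k) (m, n) else 0 := by
  simp [site23, Matrix.one_apply]

/-- Every column read by `obstruction` has `1` at both outer sites and no row contains a `1`, so an
operator fixing the first or the third site contributes nothing. -/
theorem obstruction_site12 (B : TwoSite) : obstruction (site12 B) = 0 := by
  simp [obstruction, site12_apply]

theorem obstruction_site23 (B : TwoSite) : obstruction (site23 B) = 0 := by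
  simp [obstruction, site23_apply]

theorem site12_mul_site23_apply (M N : TwoSite) (i j k l m n : Fin 3) :
    (site12 M * site23 N) ((i, j), k) ((l, m), n) = ∑ x, M (i, j) (l, x) * N (x, k) (m, n) := by
  simp [Matrix.mul_apply, Fintype.sum_prod_type, site12_apply, site23_apply]

theorem site23_mul_site12_apply (M N : TwoSite) (i j k l m n : Fin 3) :
    (site23 N * site12 M) ((i, j), k) ((l, m), n) = ∑ x, N (j, k) (x, n) * M (i, x) (l, m) := by
  simp [Matrix.mul_apply, Fintype.sum_prod_type, site12_apply, site23_apply]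

theorem site12_mul_site23_mul_site12_apply (M N L : TwoSite) (i j k l m n : Fin 3) :
    (site12 M * site23 N * site12 L) ((i, j), k) ((l, m), n) =
      ∑ y, ∑ z, (∑ x, M (i, j) (y, x) * N (x, k) (z, n)) * L (y, z) (l, m) := by
  simp [Matrix.mul_apply (M := site12 M * site23 N), Fintype.sum_prod_type, site12_apply,
    site12_mul_site23_apply]

theorem site23_mul_site12_mul_site23_apply (M N L : TwoSite) (i j k l m n : Fin 3) :
    (site23 N * site12 M * site23 L) ((i, j), k) ((l, m), n) =
      ∑ y, ∑ z, (∑ x, N (j, k) (x, z) * M (i, x) (l, y)) * L (y, z) (m, n) := by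
  rw [Matrix.mul_apply, Fintype.sum_prod_type, Fintype.sum_prod_type,
    Finset.sum_eq_single l (fun b _ hb => by simp [site23_apply, hb]) (by simp)]
  simp [site23_apply, site23_mul_site12_apply]

theorem E_kronecker_apply (i j k l : Fin 3) (p q : Fin 3 × Fin 3) :
    (E i j ⊗ₖ E k l) p q =
      if i = p.1 ∧ j = q.1 then if k = p.2 ∧ l = q.2 then 1 else 0 else 0 := by
  simp only [E, Matrix.kroneckerMap_apply, Matrix.single_apply, ite_mul, one_mul, zero_mul]

/-- The off-diagonal part of the 14-vertex (`θ = 0`) and the 17-vertex Hamiltonians. -/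
def hopping (θ : ℂ) : TwoSite := Matrix.of fun p q =>
  match p, q with
  | (0, 1), (1, 0) => 1
  | (1, 0), (0, 1) => θ
  | (0, 2), (1, 1) => 1
  | (2, 0), (1, 1) => -1
  | (1, 2), (2, 1) => 1
  | (2, 1), (1, 2) => θ
  | (0, 2), (2, 0) => 1
  | (2, 0), (0, 2) => θ
  | _, _ => 0

theorem hopping_eq (θ : ℂ) : hopping θ =
    E 0 1 ⊗ₖ E 1 0 + θ • (E 1 0 ⊗ₖ E 0 1) + E 0 1 ⊗ₖ E 2 1 - E 2 1 ⊗ₖ E 0 1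
    + E 1 2 ⊗ₖ E 2 1 + θ • (E 2 1 ⊗ₖ E 1 2) + E 0 2 ⊗ₖ E 2 0 + θ • (E 2 0 ⊗ₖ E 0 2) := by
  ext ⟨i, j⟩ ⟨k, l⟩
  simp only [Matrix.add_apply, Matrix.sub_apply, Matrix.smul_apply, E_kronecker_apply]
  fin_cases i <;> fin_cases j <;> fin_cases k <;> fin_cases l <;> simp [hopping]

theorem sum_smul_E_kronecker (v : Matrix (Fin 3) (Fin 3) ℂ) :
    ∑ i, ∑ j, v i j • (E i i ⊗ₖ E j j) = Matrix.diagonal fun p => v p.1 p.2 := by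
  ext ⟨i, j⟩ ⟨k, l⟩
  simp only [Matrix.sum_apply, Matrix.smul_apply, E, Matrix.kroneckerMap_apply,
    Matrix.single_apply, Matrix.diagonal_apply, Prod.mk.injEq]
  rw [Finset.sum_eq_single i (fun b _ hb => by simp [hb]) (by simp),
    Finset.sum_eq_single j (fun b _ hb => by simp [hb]) (by simp)]
  split_ifs <;> simp_all

theorem H14V_eq (ξ : ℂ) :
    H14V ξ = hopping 0 + Matrix.diagonal fun p => v14 ξ p.1 p.2 := by
  rw [H14V, sum_smul_E_kronecker, hopping_eq]
  simp

theorem H17V2_eq (θ : ℂ) :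
    H17V2 θ = hopping θ + Matrix.diagonal fun p => v17 θ p.1 p.2 := by
  rw [H17V2, sum_smul_E_kronecker, hopping_eq]

/-- The diagonal part of a Hamiltonian after the shifts of `HamiltonianEquiv`. -/
def shiftedDiag (v : Matrix (Fin 3) (Fin 3) ℂ) (α β : ℂ) (a : Fin 3 → ℂ) (p : Fin 3 × Fin 3) : ℂ :=
  v p.1 p.2 + α + β * (p.1.val + p.2.val) + (a p.1 - a p.2)

theorem add_shifts_eq (M : TwoSite) (v : Matrix (Fin 3) (Fin 3) ℂ) (α β : ℂ) (a : Fin 3 → ℂ) :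
    M + (Matrix.diagonal fun p => v p.1 p.2) + α • (1 : TwoSite) + β • spinTwo + telescopic a =
      M + Matrix.diagonal (shiftedDiag v α β a) := by
  simp only [spinTwo, spin, telescopic, ← Matrix.diagonal_one, Matrix.diagonal_kronecker_diagonal,
    Matrix.diagonal_add, Matrix.diagonal_sub, ← Matrix.diagonal_smul, add_assoc]
  congr 2
  funext p
  simp [shiftedDiag, add_assoc]

/-- The six entries are combined so that all contributions of the unknown `K` cancel, whatever the
diagonal part of `H`. -/
theorem obstruction_linear (K : TwoSite) (κ : ℂ) (d : Fin 3 × Fin 3 → ℂ) (H : TwoSite)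
    (hH : H = κ • (hopping 0 + Matrix.diagonal d)) :
    obstruction ((site12 H * site23 K - site23 K * site12 H)
      + (site23 H * site12 K - site12 K * site23 H)) = 0 := by
  simp only [obstruction, LinearMap.coe_mk, AddHom.coe_mk, Matrix.add_apply, Matrix.sub_apply,
    site12_mul_site23_apply, site23_mul_site12_apply, Fin.sum_univ_three]
  simp [hH, hopping]
  ring

/-- The shifts `α`, `β`, `a` drop out, so the value obstructs the whole equivalence class of the
Hamiltonian. -/
theorem obstruction_cubic (ξ κ α β : ℂ) (a : Fin 3 → ℂ) (H : TwoSite)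
    (hH : H = κ • (hopping 0 + Matrix.diagonal (shiftedDiag (v14 ξ) α β a))) :
    obstruction (2 * (site12 H * site23 H * site12 H - site23 H * site12 H * site23 H)
      + (site12 H * site23 (H * H) + site23 (H * H) * site12 H)
      - (site23 H * site12 (H * H) + site12 (H * H) * site23 H)) = κ ^ 3 * (2 * (2 - ξ)) := by
  simp only [obstruction, LinearMap.coe_mk, AddHom.coe_mk, two_mul, Matrix.add_apply,
    Matrix.sub_apply,
    site12_mul_site23_apply, site23_mul_site12_apply, site12_mul_site23_mul_site12_apply,
    site23_mul_site12_mul_site23_apply, Matrix.mul_apply (M := H), Fintype.sum_prod_type,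
    Fin.sum_univ_three]
  simp [hH, hopping, shiftedDiag, v14]
  ring

/-! ### Baxterization and the 17-vertex R-matrix. -/

/-- The action on vectors of the matrix `B` with `Ř(z) = z⁻¹ + (z - z⁻¹) (1 - θ)⁻¹ B`. -/
def baxterAction (θ : ℂ) (g : Fin 3 × Fin 3 → ℂ) : Fin 3 × Fin 3 → ℂ
  | (0, 0) => g (0, 0)
  | (0, 1) => (1 - θ) * g (0, 1) + g (1, 0)
  | (1, 0) => θ * g (0, 1)
  | (0, 2) => (1 - θ) * g (0, 2) + g (1, 1) + g (2, 0)
  | (2, 0) => θ * g (0, 2) - g (1, 1)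
  | (1, 1) => g (1, 1)
  | (1, 2) => (1 - θ) * g (1, 2) + g (2, 1)
  | (2, 1) => θ * g (1, 2)
  | (2, 2) => g (2, 2)

/-- The matrix of `baxterAction`. -/
def baxterMatrix (θ : ℂ) : TwoSite := Matrix.of fun p q => baxterAction θ (Pi.single q 1) p

theorem baxterMatrix_mulVec (θ : ℂ) (g : Fin 3 × Fin 3 → ℂ) :
    (baxterMatrix θ).mulVec g = baxterAction θ g := by
  funext ⟨i, j⟩
  fin_cases i <;> fin_cases j <;>
    simp [baxterMatrix, baxterAction, Matrix.mulVec, dotProduct, Fintype.sum_prod_type,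
      Fin.sum_univ_three, Pi.single_apply]
  ring

theorem baxterMatrix_sq (θ : ℂ) :
    baxterMatrix θ * baxterMatrix θ = (1 - θ) • baxterMatrix θ + θ • (1 : TwoSite) := by
  refine Matrix.ext_of_mulVec_single fun q => ?_
  generalize (Pi.single q 1 : Fin 3 × Fin 3 → ℂ) = g
  rw [← Matrix.mulVec_mulVec, Matrix.add_mulVec, Matrix.smul_mulVec, Matrix.smul_mulVec,
    Matrix.one_mulVec, baxterMatrix_mulVec, baxterMatrix_mulVec]
  funext ⟨i, j⟩
  fin_cases i <;> fin_cases j <;> simp [baxterAction] <;> ring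

theorem site12_mulVec (M : TwoSite) (v : (Fin 3 × Fin 3) × Fin 3 → ℂ) (p : Fin 3 × Fin 3)
    (k : Fin 3) : (site12 M).mulVec v (p, k) = M.mulVec (fun q => v (q, k)) p := by
  simp [site12, Matrix.mulVec, dotProduct, Fintype.sum_prod_type, Matrix.one_apply]

theorem site23_mulVec (M : TwoSite) (v : (Fin 3 × Fin 3) × Fin 3 → ℂ) (i j k : Fin 3) :
    (site23 M).mulVec v ((i, j), k) = M.mulVec (fun q => v ((i, q.1), q.2)) (j, k) := by
  simp only [site23, Matrix.mulVec, dotProduct, Fintype.sum_prod_type, Matrix.reindex_apply,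
    Matrix.submatrix_apply, Matrix.kroneckerMap_apply, Matrix.one_apply, Equiv.symm_symm,
    Equiv.prodAssoc_apply]
  rw [Finset.sum_eq_single i (fun b _ hb => by simp [hb.symm]) (by simp)]
  simp

theorem baxterMatrix_braid (θ : ℂ) :
    site12 (baxterMatrix θ) * site23 (baxterMatrix θ) * site12 (baxterMatrix θ) =
      site23 (baxterMatrix θ) * site12 (baxterMatrix θ) * site23 (baxterMatrix θ) := by
  refine Matrix.ext_of_mulVec_single fun q => ?_
  -- With a generic vector only the 27 output coordinates need checking, rather than all 27² matrix
  -- entries.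
  generalize (Pi.single q 1 : (Fin 3 × Fin 3) × Fin 3 → ℂ) = v
  simp only [← Matrix.mulVec_mulVec]
  have h12 : ∀ v, (site12 (baxterMatrix θ)).mulVec v =
      fun p => baxterAction θ (fun q => v (q, p.2)) p.1 := fun v => by
    funext ⟨p, k⟩
    rw [site12_mulVec, baxterMatrix_mulVec]
  have h23 : ∀ v, (site23 (baxterMatrix θ)).mulVec v =
      fun p => baxterAction θ (fun q => v ((p.1.1, q.1), q.2)) (p.1.2, p.2) := fun v => by
    funext ⟨⟨i, j⟩, k⟩
    rw [site23_mulVec, baxterMatrix_mulVec]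
  simp only [h12, h23]
  funext ⟨⟨i, j⟩, k⟩
  fin_cases i <;> fin_cases j <;> fin_cases k <;> simp [baxterAction] <;> ring

theorem braided_R17V2 (θ z : ℂ) :
    braided (R17V2 θ z) = ((1 - θ) * z⁻¹) • (1 : TwoSite) + (z - z⁻¹) • baxterMatrix θ := by
  ext ⟨i, j⟩ ⟨k, l⟩
  have h : braided (R17V2 θ z) (i, j) (k, l) = R17V2 θ z (j, i) (k, l) := by
    simp only [braided, Matrix.mul_apply, permOp]
    rw [Finset.sum_eq_single (j, i)]
    · simp
    · rintro ⟨a, b⟩ - hb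
      rw [if_neg, zero_mul]
      rintro ⟨rfl, rfl⟩
      exact hb rfl
    · simp
  rw [h]
  fin_cases i <;> fin_cases j <;> fin_cases k <;> fin_cases l <;>
    simp [R17V2, baxterMatrix, baxterAction, finProdFinEquiv] <;> ring

theorem smul_braided_R17V2 {θ : ℂ} (hθ : θ ≠ 1) (z : ℂ) :
    (1 - θ)⁻¹ • braided (R17V2 θ z) =
      z⁻¹ • (1 : TwoSite) + (z - z⁻¹) • (1 - θ)⁻¹ • baxterMatrix θ := by
  have h : 1 - θ ≠ 0 := sub_ne_zero.2 hθ.symm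
  rw [braided_R17V2, smul_add, smul_smul, smul_comm, inv_mul_cancel_left₀ h]

/-- Baxterization of a solution of the braid relation and of a quadratic relation. -/
theorem yangBaxter_of_braid {A : Type*} [Ring A] [Algebra ℂ A] {a b : A} {q : ℂ}
    (ha : a * a = a + q • 1) (hb : b * b = b + q • 1) (hab : a * b * a = b * a * b)
    {u v : ℂ} (hu : u ≠ 0) (hv : v ≠ 0) :
    (u⁻¹ • 1 + (u - u⁻¹) • a) * ((u * v)⁻¹ • 1 + (u * v - (u * v)⁻¹) • b)
        * (v⁻¹ • 1 + (v - v⁻¹) • a) =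
      (v⁻¹ • 1 + (v - v⁻¹) • b) * ((u * v)⁻¹ • 1 + (u * v - (u * v)⁻¹) • a)
        * (u⁻¹ • 1 + (u - u⁻¹) • b) := by
  simp only [mul_add, add_mul, smul_mul_assoc, mul_smul_comm, smul_smul, mul_one, one_mul,
    smul_add, ha, hb, hab]
  match_scalars <;> field_simp <;> ring

theorem smul_baxterMatrix_sq {θ : ℂ} (hθ : θ ≠ 1) :
    ((1 - θ)⁻¹ • baxterMatrix θ) * ((1 - θ)⁻¹ • baxterMatrix θ) =
      (1 - θ)⁻¹ • baxterMatrix θ + (θ * ((1 - θ)⁻¹) ^ 2) • (1 : TwoSite) := by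
  have h : 1 - θ ≠ 0 := sub_ne_zero.2 hθ.symm
  rw [smul_mul_smul_comm, baxterMatrix_sq]
  match_scalars <;> field_simp

theorem isMultiplicativeRMatrix_R17V2 {θ : ℂ} (hθ : θ ≠ 1) :
    IsMultiplicativeRMatrix {z | z ≠ 0} (fun z => (1 - θ)⁻¹ • braided (R17V2 θ z)) where
  isOpen := isOpen_ne
  one_mem := one_ne_zero
  analytic i j z hz := by
    have hz' : z ≠ 0 := hz
    simp only [smul_braided_R17V2 hθ]
    simp only [Matrix.add_apply, Matrix.smul_apply, smul_eq_mul]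
    fun_prop (disch := assumption)
  regular := by simp [smul_braided_R17V2 hθ]
  yangBaxter u hu v hv _ := by
    simp only [smul_braided_R17V2 hθ]
    set A := (1 - θ)⁻¹ • baxterMatrix θ with hA
    have hq := smul_baxterMatrix_sq hθ
    rw [← hA] at hq
    have key := yangBaxter_of_braid (a := site12Hom A) (b := site23Hom A)
      (q := θ * ((1 - θ)⁻¹) ^ 2)
      (by rw [← map_mul, hq]; simp) (by rw [← map_mul, hq]; simp)
      (by
        simp only [hA, map_smul, smul_mul_assoc, mul_smul_comm]
        exact congrArg (fun M => (1 - θ)⁻¹ • (1 - θ)⁻¹ • (1 - θ)⁻¹ • M) (baxterMatrix_braid θ))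
      (u := u) (v := v) hu hv
    change site12Hom _ * site23Hom _ * site12Hom _ = site23Hom _ * site12Hom _ * site23Hom _
    simpa only [map_add, map_smul, map_one] using key

/-- The `(0,0)` entry fixes `α`, the sum of the `(0,1)` and `(1,0)` entries fixes `β`, and the
differences between the `(0,j)` and `(j,0)` entries fix `a` up to a constant. -/
theorem baxterMatrix_sub_smul_one (θ : ℂ) :
    baxterMatrix θ - ((1 - θ) / 2) • (1 : TwoSite) = hopping θ + Matrix.diagonal
      (shiftedDiag (v17 θ) ((1 + θ) / 2) (-(1 + θ) / 2) ![(1 - θ) / 2, 0, 0]) := by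
  ext ⟨i, j⟩ ⟨k, l⟩
  fin_cases i <;> fin_cases j <;> fin_cases k <;> fin_cases l <;>
    simp [baxterMatrix, baxterAction, hopping, shiftedDiag, v17] <;> ring

theorem generatesUniAt_R17V2 {θ : ℂ} (hθ : θ ≠ 1) :
    GeneratesUniAt (fun z => (1 - θ)⁻¹ • braided (R17V2 θ z)) 1 (H17V2 θ) := by
  have h : 1 - θ ≠ 0 := sub_ne_zero.2 hθ.symm
  refine ⟨(-1 : ℂ) • (1 : TwoSite) + (2 : ℂ) • (1 - θ)⁻¹ • baxterMatrix θ,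
    ⟨2 * (1 - θ)⁻¹, (1 + θ) / 2, -(1 + θ) / 2, ![(1 - θ) / 2, 0, 0], by simp [h], ?_⟩,
    fun i j => ?_⟩
  · rw [show (-1 : ℂ) • (1 : TwoSite) + (2 : ℂ) • (1 - θ)⁻¹ • baxterMatrix θ =
      (2 * (1 - θ)⁻¹) • (baxterMatrix θ - ((1 - θ) / 2) • (1 : TwoSite)) by
        match_scalars <;> field_simp]
    rw [H17V2_eq, add_shifts_eq, baxterMatrix_sub_smul_one]
  · simp only [smul_braided_R17V2 hθ]
    simp only [Matrix.add_apply, Matrix.smul_apply, smul_eq_mul]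
    have h1 : HasDerivAt (fun z : ℂ => z⁻¹) (-1) 1 := by
      simpa using hasDerivAt_inv (one_ne_zero (α := ℂ))
    refine ((h1.mul_const ((1 : TwoSite) i j)).add
      (((hasDerivAt_id (1 : ℂ)).sub h1).mul_const ((1 - θ)⁻¹ * baxterMatrix θ i j))).congr_deriv ?_
    ring

theorem H14V_two : H14V 2 = H17V2 0 := by
  have h : v14 2 = v17 0 := by
    ext i j
    fin_cases i <;> fin_cases j <;> norm_num [v14, v17]
  simp [H14V, H17V2, h]

theorem braided_R17V2_zero_unitary {z : ℂ} (hz : z ≠ 0) :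
    braided (R17V2 0 z) * braided (R17V2 0 z⁻¹) = 1 := by
  have hq : baxterMatrix 0 * baxterMatrix 0 = baxterMatrix 0 := by
    simpa using baxterMatrix_sq 0
  simp only [braided_R17V2, mul_add, add_mul, smul_mul_assoc, mul_smul_comm, smul_smul, mul_one,
    one_mul, smul_add, hq]
  match_scalars <;> field_simp <;> ring

/-! ### Nonexistence, and reduction of univariate to bivariate solutions. -/

/-- The compatibility condition on the Hamiltonian of a bivariate `R`-matrix. -/
theorem IsBivariateRMatrix.exists_compatibility {U : Set ℂ} {R : ℂ → ℂ → TwoSite} {t : ℂ}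
    {H : TwoSite} (hR : IsBivariateRMatrix U R) (ht : t ∈ U)
    (hH : ∀ i j, HasDerivAt (fun x => R x t i j) (H i j) t) :
    ∃ K B C : TwoSite,
      2 * (site12 H * site23 H * site12 H - site23 H * site12 H * site23 H)
      + (site12 H * site23 (H * H) + site23 (H * H) * site12 H)
      - (site23 H * site12 (H * H) + site12 (H * H) * site23 H)
      + (site12 H * site23 K - site23 K * site12 H)
      + (site23 H * site12 K - site12 K * site23 H)
      + site12 B + site23 C = 0 := by
  have hU : U ∈ 𝓝 t := hR.isOpen.mem_nhds ht
  have hU1 : ∀ᶠ ε in 𝓝 (0 : ℂ), t + ε ∈ U :=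
    ContinuousAt.eventually_mem (f := fun ε => t + ε) (by fun_prop) (by simpa using hU)
  have hU2 : ∀ᶠ ε in 𝓝 (0 : ℂ), t - ε ∈ U :=
    ContinuousAt.eventually_mem (f := fun ε => t - ε) (by fun_prop) (by simpa using hU)
  have han : ∀ i j, AnalyticAt ℂ (fun p : ℂ × ℂ => R p.1 p.2 i j) (t, t) :=
    fun i j => hR.analytic i j _ ⟨ht, ht⟩
  have hline : ∀ a b : ℂ, ∀ i j,
      AnalyticAt ℂ (fun ε => R (t + a * ε) (t + b * ε) i j) 0 ∧
      HasDerivAt (fun ε => R (t + a * ε) (t + b * ε) i j) ((a - b) * H i j) 0 := by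
    intro a b i j
    have hcurve : ∀ a b : ℂ, HasDerivAt (fun ε : ℂ => (t + a * ε, t + b * ε)) (a, b) 0 :=
      fun a b => by
        simpa using (((hasDerivAt_id (0 : ℂ)).const_mul a).const_add t).prodMk
          (((hasDerivAt_id (0 : ℂ)).const_mul b).const_add t)
    obtain ⟨L, hL⟩ := (han i j).differentiableAt
    have hd : ∀ a b : ℂ, HasDerivAt (fun ε => R (t + a * ε) (t + b * ε) i j) (L (a, b)) 0 :=
      fun a b => HasFDerivAt.comp_hasDerivAt_of_eq (0 : ℂ) hL (hcurve a b) (by simp)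
    -- `Ř` is constant along the diagonal, so its differential at `(t, t)` depends only on `a - b`.
    have h11 : L (1, 1) = 0 := by
      refine (hd 1 1).unique
        ((hasDerivAt_const (0 : ℂ) ((1 : TwoSite) i j)).congr_of_eventuallyEq ?_)
      filter_upwards [hU1] with ε hε
      rw [one_mul, hR.regular _ hε]
    have h10 : L (1, 0) = H i j := by
      refine (hd 1 0).unique ?_
      have := HasDerivAt.scomp_of_eq (0 : ℂ) (hH i j)
        (((hasDerivAt_id (0 : ℂ)).const_add t)) (by simp)
      simpa [Function.comp_def] using this
    have hLab : L (a, b) = (a - b) * H i j := by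
      rw [show ((a, b) : ℂ × ℂ) = (a - b) • (1, 0) + b • (1, 1) by simp, map_add, map_smul,
        map_smul, h11, h10]
      simp
    refine ⟨?_, hLab ▸ hd a b⟩
    exact AnalyticAt.fun_comp_of_eq (han i j) (f := fun ε : ℂ => (t + a * ε, t + b * ε))
      (by fun_prop) (by simp)
  have hT : ∀ a b : ℂ, ∃ a₂ a₃,
      HasTaylor (fun ε => R (t + a * ε) (t + b * ε)) 1 ((a - b) • H) a₂ a₃ := by
    intro a b
    have := exists_hasTaylor_matrix (f := fun ε => R (t + a * ε) (t + b * ε)) (D := (a - b) • H)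
      (fun i j => (hline a b i j).1) (fun i j => (hline a b i j).2)
    simpa [hR.regular t ht] using this
  -- Equal spacing of the three points gives the first-order coefficients `H`, `H` and `2H`.
  obtain ⟨F, F', hF⟩ := hT 1 0
  obtain ⟨G, G', hG⟩ := hT 0 (-1)
  obtain ⟨S, S', hS⟩ := hT 1 (-1)
  rw [sub_zero, one_smul] at hF
  rw [zero_sub, neg_neg, one_smul] at hG
  rw [sub_neg_eq_add, add_smul, one_smul] at hS
  refine exists_of_hasTaylor hF hG hS ?_
  filter_upwards [hU1, hU2] with ε h1 h2
  have := hR.yangBaxter (t + ε) h1 t ht (t - ε) h2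
  simpa [sub_eq_add_neg] using this

theorem not_hasBivariateRMatrix_H14V {ξ : ℂ} (hξ : ξ ≠ 2) : ¬ HasBivariateRMatrix (H14V ξ) := by
  rintro ⟨U, R, t, hR, ht, H, ⟨κ, α, β, a, hκ, hH⟩, hd⟩
  rw [H14V_eq, add_shifts_eq] at hH
  obtain ⟨K, B, C, h⟩ := hR.exists_compatibility ht hd
  have h0 := congrArg obstruction h
  rw [map_add, map_add, add_assoc _ (_ - _) (_ - _), map_add, obstruction_cubic ξ κ α β a H hH,
    obstruction_linear K κ _ H hH, obstruction_site12, obstruction_site23, map_zero] at h0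
  simp only [add_zero, mul_eq_zero, pow_eq_zero_iff three_ne_zero, hκ,
    sub_eq_zero, OfNat.ofNat_ne_zero, false_or] at h0
  exact hξ h0.symm

theorem HasAdditiveRMatrix.hasBivariateRMatrix {H : TwoSite} (h : HasAdditiveRMatrix H) :
    HasBivariateRMatrix H := by
  obtain ⟨V, R, hR, H', hH, hd⟩ := h
  obtain ⟨r, hr, hrV⟩ := Metric.isOpen_iff.1 hR.isOpen 0 hR.zero_mem
  have hV : ∀ x ∈ Metric.ball (0 : ℂ) (r / 2), ∀ y ∈ Metric.ball (0 : ℂ) (r / 2), x - y ∈ V := by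
    intro x hx y hy
    apply hrV
    rw [mem_ball_zero_iff] at *
    linarith [norm_sub_le x y]
  -- Half the radius keeps all differences `x - y` inside `V`.
  refine ⟨Metric.ball 0 (r / 2), fun x y => R (x - y), 0, ⟨Metric.isOpen_ball, ?_, ?_, ?_⟩,
    Metric.mem_ball_self (half_pos hr), H', hH, by simpa using hd⟩
  · rintro i j ⟨x, y⟩ ⟨hx, hy⟩
    exact AnalyticAt.fun_comp_of_eq (hR.analytic i j _ (hV x hx y hy))
      (f := fun p : ℂ × ℂ => p.1 - p.2) (analyticAt_fst.sub analyticAt_snd) rfl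
  · intro x _
    rw [sub_self, hR.regular]
  · intro x hx y hy z hz
    have := hR.yangBaxter (y - z) (hV y hy z hz) (x - y) (hV x hx y hy)
    rw [show y - z + (x - y) = x - z by ring] at this
    exact this (hV x hx z hz)

theorem HasMultiplicativeRMatrix.hasAdditiveRMatrix {H : TwoSite}
    (h : HasMultiplicativeRMatrix H) : HasAdditiveRMatrix H := by
  obtain ⟨V, R, hR, H', hH, hd⟩ := h
  -- Since `exp' 0 = 1`, the same `H'` serves as derivative.
  refine ⟨Complex.exp ⁻¹' V, fun u => R (Complex.exp u), ⟨?_, ?_, ?_, ?_, ?_⟩, H', hH, ?_⟩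
  · exact hR.isOpen.preimage Complex.continuous_exp
  · simpa using hR.one_mem
  · intro i j u hu
    exact AnalyticAt.fun_comp (hR.analytic i j _ hu) (f := Complex.exp) (by fun_prop)
  · simpa using hR.regular
  · intro u hu v hv huv
    have := hR.yangBaxter _ hu _ hv
    rw [← Complex.exp_add] at this
    exact this huv
  · intro i j
    have := HasDerivAt.scomp_of_eq (0 : ℂ) (hd i j) (Complex.hasDerivAt_exp 0) (by simp)
    simpa [Function.comp_def] using this

end ThreeState

theorem mainTheorem1 :
    -- no regular bivariate or univariate solution of the YBE generates `H14V ξ` when `ξ ≠ 2`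
    (∀ ξ : ℂ, ξ ≠ 2 →
      ¬ ThreeState.HasBivariateRMatrix (ThreeState.H14V ξ) ∧
      ¬ ThreeState.HasAdditiveRMatrix (ThreeState.H14V ξ) ∧
      ¬ ThreeState.HasMultiplicativeRMatrix (ThreeState.H14V ξ)) ∧
    -- `H17V2 θ` is the Hamiltonian of the 17-vertex `R`-matrix (normalised to be regular)
    (∀ θ : ℂ, θ ≠ 1 →
      ThreeState.IsMultiplicativeRMatrix {z | z ≠ 0}
        (fun z => (1 - θ)⁻¹ • ThreeState.braided (ThreeState.R17V2 θ z)) ∧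
      ThreeState.GeneratesUniAt
        (fun z => (1 - θ)⁻¹ • ThreeState.braided (ThreeState.R17V2 θ z)) 1
        (ThreeState.H17V2 θ)) ∧
    -- at `ξ = 2` the 14-vertex Hamiltonian is the case `θ = 0` of the 17-vertex one
    ThreeState.H14V 2 = ThreeState.H17V2 0 ∧
    -- hence it is generated by the 17-vertex `R`-matrix at `θ = 0`
    ThreeState.IsMultiplicativeRMatrix {z | z ≠ 0}
      (fun z => ThreeState.braided (ThreeState.R17V2 0 z)) ∧
    (∀ z : ℂ, z ≠ 0 →
      ThreeState.braided (ThreeState.R17V2 0 z) * ThreeState.braided (ThreeState.R17V2 0 z⁻¹) = 1) ∧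
    ThreeState.GeneratesUniAt (fun z => ThreeState.braided (ThreeState.R17V2 0 z)) 1
      (ThreeState.H14V 2) := by
  refine ⟨fun ξ hξ => ?_, fun θ hθ => ?_, ThreeState.H14V_two, ?_, ?_, ?_⟩
  · have h := ThreeState.not_hasBivariateRMatrix_H14V hξ
    exact ⟨h, fun ha => h ha.hasBivariateRMatrix,
      fun hm => h hm.hasAdditiveRMatrix.hasBivariateRMatrix⟩
  · exact ⟨ThreeState.isMultiplicativeRMatrix_R17V2 hθ, ThreeState.generatesUniAt_R17V2 hθ⟩
  · simpa using ThreeState.isMultiplicativeRMatrix_R17V2 (θ := 0) zero_ne_one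
  · exact fun z hz => ThreeState.braided_R17V2_zero_unitary hz
  · simpa [ThreeState.H14V_two] using ThreeState.generatesUniAt_R17V2 (θ := 0) zero_ne_one
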